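/- Let $N\ge 1$ and let $\Omega\subset\mathbb{R}^N$ be a bounded set, $\Omega=A\cup B$ with $A,B$ disjoint, measurable and with nonempty interior, where $A$ differs from its interior only by a Lebesgue null set. $H^1(A)$ denotes the space of $u\in L^2(A)$ having a weak gradient $\nabla u\in L^2(A;\mathbb{R}^N)$ (integration by parts against $C_c^\infty(\operatorname{int}A)$). Let $J,G:\mathbb{R}^N\to\mathbb{R}$ be continuous, nonnegative, radial, compactly supported, positive at the origin and of integral one, and suppose that $B_R(0)\subset\operatorname{supp}J$ for some $R>\operatorname{diam}(A\cup B)$. Put $$W=\Big\{(u,v)\in H^1(A)\times L^2(B):\ \int_A u\,dx+\int_B v\,dx=0\Big\},$$ $$a\big((u,v),(\varphi,\phi)\big)=\int_A\nabla u\cdot\nabla\varphi\,dx+\frac12\iint_{B\times B}G(x-y)(v(y)-v(x))(\phi(y)-\phi(x))\,dx\,dy+\iint_{A\times B}J(x-y)(u(x)-v(y))(\varphi(x)-\phi(y))\,dx\,dy .$$ Let $f\in L^2(\Omega)$ satisfy $\int_A f\,dx+\int_B f\,dx=0$, and let $$E(u,v)=\frac12\int_A|\nabla u|^2\,dx+\frac14\iint_{B\times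 B}G(x-y)(v(y)-v(x))^2\,dx\,dy+\frac12\iint_{A\times B}J(x-y)(v(y)-u(x))^2\,dx\,dy+\int_A fu\,dx+\int_B fv\,dx .$$ A weak solution of the coupled local/nonlocal Neumann system $$\Delta u(x)+\int_B J(x-y)(v(y)-u(x))\,dy=f(x)\ \ (x\in A),\qquad \frac{\partial u}{\partial\eta}=0\ \text{ on }\partial A,$$ $$\int_B G(x-y)(v(y)-v(x))\,dy+\int_A J(x-y)(u(y)-v(x))\,dy=f(x)\ \ (x\in B)$$ is a pair $(u,v)\in W$ with $a((u,v),(\varphi,\phi))=-\int_A f\varphi\,dx-\int_B f\phi\,dx$ for all $(\varphi,\phi)\in W$. Then there is a pair $(u,v)\in W$ that is the unique weak solution of the system and also the unique minimizer of $E$ over $W$. Moreover, the identity $a((u,v),(\varphi,\phi))=-\int_A f\varphi\,dx-\int_B f\phi\,dx$ then holds for all $(\varphi,\phi)\in H^1(A)\times L^2(B)$. -/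

import Mathlib

open MeasureTheory
open scoped ContDiff

namespace LocalNonlocal

noncomputable section

/-- `ℝ^N` with the Euclidean norm. -/
abbrev Space (N : ℕ) : Type := EuclideanSpace ℝ (Fin N)

/-- The real Hilbert space `L²(S)`. -/
abbrev L2 {N : ℕ} (S : Set (Space N)) : Type := Lp ℝ 2 (volume.restrict S)

/-- The real Hilbert space `L²(S; ℝ^N)`. -/
abbrev L2Vec {N : ℕ} (S : Set (Space N)) : Type := Lp (Space N) 2 (volume.restrict S)

/-- Admissible kernels: continuous, nonnegative, radial, compactly supported,
positive at the origin and of total mass one. -/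
structure IsAdmissibleKernel {N : ℕ} (K : Space N → ℝ) : Prop where
  continuous : Continuous K
  nonneg : ∀ z, 0 ≤ K z
  radial : ∀ z z', ‖z‖ = ‖z'‖ → K z = K z'
  hasCompactSupport : HasCompactSupport K
  pos_zero : 0 < K 0
  integral_eq_one : ∫ z, K z = 1

/-- The partial derivative `∂φ/∂xᵢ`. -/
def partialDeriv {N : ℕ} (i : Fin N) (φ : Space N → ℝ) (x : Space N) : ℝ :=
  fderiv ℝ φ x (EuclideanSpace.single i 1)

/-- `g` is a weak (distributional) gradient of `u` on `A`: integration by parts holds against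
every smooth test function with compact support in the interior of `A`. (In the theorem, `A`
differs from its interior only by a null set.) -/
def HasWeakGrad {N : ℕ} {A : Set (Space N)} (u : L2 A) (g : L2Vec A) : Prop :=
  ∀ φ : Space N → ℝ, ContDiff ℝ ∞ φ → HasCompactSupport φ → tsupport φ ⊆ interior A →
    ∀ i : Fin N, ∫ x in A, u x * partialDeriv i φ x = - ∫ x in A, g x i * φ x

theorem memLp_test {N : ℕ} {A : Set (Space N)} {φ : Space N → ℝ} (hφ : Continuous φ)
    (hc : HasCompactSupport φ) : MemLp φ 2 (volume.restrict A) :=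
  (hφ.memLp_of_hasCompactSupport hc).restrict A

theorem memLp_partialDeriv {N : ℕ} {A : Set (Space N)} {φ : Space N → ℝ} (hφ : ContDiff ℝ ∞ φ)
    (hc : HasCompactSupport φ) (i : Fin N) : MemLp (partialDeriv i φ) 2 (volume.restrict A) := by
  refine memLp_test ?_ ?_
  · exact (hφ.continuous_fderiv (by simp)).clm_apply continuous_const
  · exact hc.fderiv_apply (𝕜 := ℝ) _

theorem memLp_coord {N : ℕ} {A : Set (Space N)} (g : L2Vec A) (i : Fin N) :
    MemLp (fun x => g x i) 2 (volume.restrict A) :=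
  (EuclideanSpace.proj (𝕜 := ℝ) i : Space N →L[ℝ] ℝ).comp_memLp' (Lp.memLp g)

theorem HasWeakGrad.zero {N : ℕ} {A : Set (Space N)} :
    HasWeakGrad (0 : L2 A) (0 : L2Vec A) := by
  intro φ _ _ _ i
  have h1 : ∫ x in A, (0 : L2 A) x * partialDeriv i φ x = 0 := by
    refine integral_eq_zero_of_ae ?_
    filter_upwards [Lp.coeFn_zero ℝ 2 (volume.restrict A)] with x hx
    rw [hx]; simp
  have h2 : ∫ x in A, (0 : L2Vec A) x i * φ x = 0 := by
    refine integral_eq_zero_of_ae ?_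
    filter_upwards [Lp.coeFn_zero (Space N) 2 (volume.restrict A)] with x hx
    rw [hx]; simp
  rw [h1, h2, neg_zero]

theorem HasWeakGrad.add {N : ℕ} {A : Set (Space N)} {u u' : L2 A} {g g' : L2Vec A}
    (h : HasWeakGrad u g) (h' : HasWeakGrad u' g') : HasWeakGrad (u + u') (g + g') := by
  intro φ hφ hc hs i
  have hd := memLp_partialDeriv (A := A) hφ hc i
  have hφ2 := memLp_test (A := A) hφ.continuous hc
  have h1 : ∫ x in A, (u + u') x * partialDeriv i φ x
      = (∫ x in A, u x * partialDeriv i φ x) + ∫ x in A, u' x * partialDeriv i φ x := by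
    refine Eq.trans ?_
      (integral_add ((Lp.memLp u).integrable_mul hd) ((Lp.memLp u').integrable_mul hd))
    refine integral_congr_ae ?_
    filter_upwards [Lp.coeFn_add u u'] with x hx
    rw [hx]; simp [add_mul]
  have h2 : ∫ x in A, (g + g') x i * φ x
      = (∫ x in A, g x i * φ x) + ∫ x in A, g' x i * φ x := by
    refine Eq.trans ?_ (integral_add ((memLp_coord g i).integrable_mul hφ2)
      ((memLp_coord g' i).integrable_mul hφ2))
    refine integral_congr_ae ?_
    filter_upwards [Lp.coeFn_add g g'] with x hx
    rw [hx]; simp [add_mul]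
  rw [h1, h2, h φ hφ hc hs i, h' φ hφ hc hs i]
  ring

theorem HasWeakGrad.smul {N : ℕ} {A : Set (Space N)} {u : L2 A} {g : L2Vec A} (c : ℝ)
    (h : HasWeakGrad u g) : HasWeakGrad (c • u) (c • g) := by
  intro φ hφ hc hs i
  have h1 : ∫ x in A, (c • u) x * partialDeriv i φ x
      = c * ∫ x in A, u x * partialDeriv i φ x := by
    rw [← integral_const_mul]
    refine integral_congr_ae ?_
    filter_upwards [Lp.coeFn_smul c u] with x hx
    rw [hx]; simp [mul_assoc]
  have h2 : ∫ x in A, (c • g) x i * φ x = c * ∫ x in A, g x i * φ x := by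
    rw [← integral_const_mul]
    refine integral_congr_ae ?_
    filter_upwards [Lp.coeFn_smul c g] with x hx
    rw [hx]; simp [mul_assoc]
  rw [h1, h2, h φ hφ hc hs i]
  ring

/-- The Sobolev space `H¹(A)`: functions in `L²(A)` with a weak gradient in `L²(A; ℝ^N)`. -/
def H1 {N : ℕ} (A : Set (Space N)) : Submodule ℝ (L2 A) where
  carrier := {u | ∃ g : L2Vec A, HasWeakGrad u g}
  zero_mem' := ⟨0, HasWeakGrad.zero⟩
  add_mem' := fun ⟨g, hg⟩ ⟨g', hg'⟩ => ⟨g + g', hg.add hg'⟩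
  smul_mem' := fun c _ ⟨g, hg⟩ => ⟨c • g, hg.smul c⟩

open Classical in
/-- The weak gradient `∇u` of `u ∈ H¹(A)` (and `0` if `u ∉ H¹(A)`). -/
def weakGrad {N : ℕ} {A : Set (Space N)} (u : L2 A) : L2Vec A :=
  if h : ∃ g : L2Vec A, HasWeakGrad u g then h.choose else 0

/-- The space `W` of pairs `(u, v) ∈ H¹(A) × L²(B)` with `∫_A u + ∫_B v = 0`. -/
def W {N : ℕ} (A B : Set (Space N)) : Set (L2 A × L2 B) :=
  {w | w.1 ∈ H1 A ∧ (∫ x in A, w.1 x) + (∫ x in B, w.2 x) = 0}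

/-- The bilinear form
`a((u,v),(φ,ψ)) = ∫_A ∇u·∇φ + ½ ∬_{B×B} G(x-y)(v(y)-v(x))(ψ(y)-ψ(x))
  + ∬_{A×B} J(x-y)(u(x)-v(y))(φ(x)-ψ(y))`. -/
def form {N : ℕ} (J G : Space N → ℝ) {A B : Set (Space N)} (w t : L2 A × L2 B) : ℝ :=
  (∫ x in A, inner ℝ (weakGrad w.1 x) (weakGrad t.1 x))
    + 1 / 2 * (∫ p in B ×ˢ B, G (p.1 - p.2) * (w.2 p.2 - w.2 p.1) * (t.2 p.2 - t.2 p.1))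
    + ∫ p in A ×ˢ B, J (p.1 - p.2) * (w.1 p.1 - w.2 p.2) * (t.1 p.1 - t.2 p.2)

/-- The load `F(φ,ψ) = ∫_A f φ + ∫_B f ψ`. -/
def load {N : ℕ} (f : Space N → ℝ) {A B : Set (Space N)} (t : L2 A × L2 B) : ℝ :=
  (∫ x in A, f x * t.1 x) + ∫ x in B, f x * t.2 x

/-- `w = (u, v) ∈ W` is a weak solution of the coupled local/nonlocal Neumann system with
source `f`: `a(w, t) = -F(t)` for every `t ∈ W`. -/
def IsWeakSolution {N : ℕ} (J G f : Space N → ℝ) {A B : Set (Space N)} (w : L2 A × L2 B) : Prop :=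
  w ∈ W A B ∧ ∀ t ∈ W A B, form J G w t = - load f t

/-- The energy
`E(u,v) = ½ ∫_A |∇u|² + ¼ ∬_{B×B} G(x-y)(v(y)-v(x))² + ½ ∬_{A×B} J(x-y)(v(y)-u(x))²
  + ∫_A f u + ∫_B f v`. -/
def energy {N : ℕ} (J G f : Space N → ℝ) {A B : Set (Space N)} (w : L2 A × L2 B) : ℝ :=
  1 / 2 * (∫ x in A, ‖weakGrad w.1 x‖ ^ 2)
    + 1 / 4 * (∫ p in B ×ˢ B, G (p.1 - p.2) * (w.2 p.2 - w.2 p.1) ^ 2)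
    + 1 / 2 * (∫ p in A ×ˢ B, J (p.1 - p.2) * (w.2 p.2 - w.1 p.1) ^ 2)
    + (∫ x in A, f x * w.1 x) + ∫ x in B, f x * w.2 x

/-- `w` minimizes the energy over `W`. -/
def IsEnergyMinimizer {N : ℕ} (J G f : Space N → ℝ) {A B : Set (Space N)}
    (w : L2 A × L2 B) : Prop :=
  w ∈ W A B ∧ ∀ w' ∈ W A B, energy J G f w ≤ energy J G f w'

end

end LocalNonlocal

open LocalNonlocal

/-! The theorem is Lax–Milgram for the form `a` on `W`, and the point is coercivity. It rests on a
nonlocal Poincaré inequality: for pairs of total mean zero, `‖u‖² + ‖v‖² ≤ C ∬_{A×B}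
J(x-y)(u(x)-v(y))²` (`IsAdmissibleKernel.exists_norm_sq_le`). The `J` term alone controls the `L²`
norms, so neither connectedness of `A` nor a compact Sobolev embedding enters, and the `G` term only
has to be nonnegative.

The inequality holds because any two points of `B` interact with a common part of `A` of uniformly
positive weight (`IsAdmissibleKernel.exists_pos_le_integral_min`, by compactness). Passing through
that part bounds the oscillation of `v`; comparing `u(x)` with the values of `v` that interact with
`x` bounds `u - v`; and a pair of total mean zero is no farther from zero than from any other
constant.

Lax–Milgram needs a complete space. It is the set of triples `(u, v, ∇u)` with `(u, v) ∈ W`, closed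
in a product of `L²` spaces because the weak gradient has a closed graph (`isClosed_hasWeakGrad`).
By symmetry of `a`, the solution `w` satisfies `E(w') = E(w) + ½ a(w'-w, w'-w)` on `W`, which gives
minimality and its uniqueness. Constant pairs annihilate both `a` and the load, so the identity
extends from `W` to all test pairs. -/

namespace LocalNonlocal

open scoped ENNReal

/-! ### An abstract nonlocal Poincaré inequality. -/

section Poincare

/-- The squared distance of two reals, as an extended nonnegative real. -/
noncomputable def sqDist (s t : ℝ) : ℝ≥0∞ := ENNReal.ofReal ((s - t) ^ 2)

theorem sqDist_comm (s t : ℝ) : sqDist s t = sqDist t s := by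
  rw [sqDist, sqDist, sub_sq_comm]

theorem sqDist_le (r s t : ℝ) : sqDist r t ≤ 2 * (sqDist r s + sqDist s t) := by
  rw [sqDist, sqDist, sqDist, ← ENNReal.ofReal_add (sq_nonneg _) (sq_nonneg _),
    show (2 : ℝ≥0∞) = ENNReal.ofReal 2 by simp, ← ENNReal.ofReal_mul (by norm_num)]
  apply ENNReal.ofReal_le_ofReal
  nlinarith [sq_nonneg ((r - s) - (s - t))]

theorem measurable_sqDist : Measurable fun p : ℝ × ℝ => sqDist p.1 p.2 := by
  unfold sqDist
  fun_prop

variable {α β : Type*} [MeasurableSpace α] [MeasurableSpace β] {μ : Measure α} {ν : Measure β}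

theorem measurable_mul_sqDist {k : α → β → ℝ≥0∞} (hk : Measurable (Function.uncurry k))
    {u : α → ℝ} {v : β → ℝ} (hu : Measurable u) (hv : Measurable v) :
    Measurable (Function.uncurry fun x y => k x y * sqDist (u x) (v y)) :=
  hk.mul (measurable_sqDist.comp ((hu.comp measurable_fst).prodMk (hv.comp measurable_snd)))

/-- The values `v y` and `v y'` are compared through `u x`, with weight `min (k x y) (k x y')` so
that each half is dominated by its own kernel. The factor 4 is the 2 of `sqDist_le`, doubled because
`y` and `y'` contribute equally. Working in `ℝ≥0∞` avoids integrability conditions. -/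
theorem mul_lintegral_sqDist_snd_le [SFinite μ] [SFinite ν]
    {k : α → β → ℝ≥0∞} (hk : Measurable (Function.uncurry k))
    {u : α → ℝ} {v : β → ℝ} (hu : Measurable u) (hv : Measurable v) {c : ℝ≥0∞}
    (hc : ∀ᵐ y ∂ν, ∀ᵐ y' ∂ν, c ≤ ∫⁻ x, min (k x y) (k x y') ∂μ) :
    c * ∫⁻ y, ∫⁻ y', sqDist (v y) (v y') ∂ν ∂ν
      ≤ 4 * (ν Set.univ * ∫⁻ y, ∫⁻ x, k x y * sqDist (u x) (v y) ∂μ ∂ν) := by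
  have hm := measurable_mul_sqDist hk hu hv
  set e : β → ℝ≥0∞ := fun y => ∫⁻ x, k x y * sqDist (u x) (v y) ∂μ with he
  have hem : Measurable e := hm.lintegral_prod_left'
  have hxm (y : β) : Measurable fun x => k x y * sqDist (u x) (v y) :=
    hm.comp (measurable_id.prodMk measurable_const)
  have hvm : Measurable fun p : β × β => sqDist (v p.1) (v p.2) :=
    measurable_sqDist.comp ((hv.comp measurable_fst).prodMk (hv.comp measurable_snd))
  have key : ∀ᵐ y ∂ν, ∀ᵐ y' ∂ν, c * sqDist (v y) (v y') ≤ 2 * (e y + e y') := by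
    filter_upwards [hc] with y hy
    filter_upwards [hy] with y' hy'
    have hkm : Measurable fun x => min (k x y) (k x y') :=
      (hk.comp (measurable_id.prodMk measurable_const)).min
        (hk.comp (measurable_id.prodMk measurable_const))
    calc c * sqDist (v y) (v y')
        ≤ (∫⁻ x, min (k x y) (k x y') ∂μ) * sqDist (v y) (v y') := by gcongr
      _ = ∫⁻ x, min (k x y) (k x y') * sqDist (v y) (v y') ∂μ :=
          (lintegral_mul_const _ hkm).symm
      _ ≤ ∫⁻ x, 2 * (k x y * sqDist (u x) (v y) + k x y' * sqDist (u x) (v y')) ∂μ := by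
          refine lintegral_mono fun x => ?_
          calc min (k x y) (k x y') * sqDist (v y) (v y')
              ≤ min (k x y) (k x y') * (2 * (sqDist (v y) (u x) + sqDist (u x) (v y'))) := by
                gcongr; exact sqDist_le _ _ _
            _ = 2 * (min (k x y) (k x y') * sqDist (u x) (v y)
                  + min (k x y) (k x y') * sqDist (u x) (v y')) := by
                rw [sqDist_comm (v y) (u x)]; ring
            _ ≤ _ := by
                gcongr
                · exact min_le_left _ _
                · exact min_le_right _ _
      _ = 2 * (e y + e y') := by
          rw [lintegral_const_mul' _ _ (by simp), lintegral_add_left (hxm y)]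
  calc c * ∫⁻ y, ∫⁻ y', sqDist (v y) (v y') ∂ν ∂ν
      = ∫⁻ y, ∫⁻ y', c * sqDist (v y) (v y') ∂ν ∂ν := by
        rw [← lintegral_const_mul _ hvm.lintegral_prod_right']
        refine lintegral_congr fun y => ?_
        exact (lintegral_const_mul _ (hvm.comp (measurable_const.prodMk measurable_id))).symm
    _ ≤ ∫⁻ y, ∫⁻ y', 2 * (e y + e y') ∂ν ∂ν := by
        refine lintegral_mono_ae ?_
        filter_upwards [key] with y hy using lintegral_mono_ae hy
    _ = ∫⁻ y, 2 * (e y * ν Set.univ + ∫⁻ y', e y' ∂ν) ∂ν := by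
        refine lintegral_congr fun y => ?_
        rw [lintegral_const_mul' _ _ (by simp), lintegral_add_left measurable_const,
          lintegral_const]
    _ = 4 * (ν Set.univ * ∫⁻ y, e y ∂ν) := by
        rw [lintegral_const_mul' _ _ (by simp), lintegral_add_left (hem.mul_const _),
          lintegral_mul_const _ hem, lintegral_const]
        ring

/-- Here `u x` is compared with `v y` through `v y'`, with weight `k x y'`. The kernel is kept on
the `u`–`v` half and replaced by its bound `M` on the `v`–`v` half, which the previous lemma
controls. -/
theorem mul_lintegral_sqDist_le [SFinite μ] [SFinite ν]
    {k : α → β → ℝ≥0∞} (hk : Measurable (Function.uncurry k))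
    {u : α → ℝ} {v : β → ℝ} (hu : Measurable u) (hv : Measurable v) {c M : ℝ≥0∞}
    (hc : ∀ᵐ x ∂μ, c ≤ ∫⁻ y, k x y ∂ν) (hM : ∀ x y, k x y ≤ M) :
    c * ∫⁻ x, ∫⁻ y, sqDist (u x) (v y) ∂ν ∂μ
      ≤ 2 * (ν Set.univ * (∫⁻ y, ∫⁻ x, k x y * sqDist (u x) (v y) ∂μ ∂ν)
        + M * μ Set.univ * ∫⁻ y, ∫⁻ y', sqDist (v y) (v y') ∂ν ∂ν) := by
  have hm := measurable_mul_sqDist hk hu hv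
  rw [← lintegral_lintegral_swap hm.aemeasurable]
  set e : α → ℝ≥0∞ := fun x => ∫⁻ y, k x y * sqDist (u x) (v y) ∂ν with he
  have hem : Measurable e := hm.lintegral_prod_right'
  have hym (x : α) : Measurable fun y => k x y * sqDist (u x) (v y) :=
    hm.comp (measurable_const.prodMk measurable_id)
  have huv : Measurable fun p : α × β => sqDist (u p.1) (v p.2) :=
    measurable_sqDist.comp ((hu.comp measurable_fst).prodMk (hv.comp measurable_snd))
  have hvm : Measurable fun p : β × β => sqDist (v p.1) (v p.2) :=
    measurable_sqDist.comp ((hv.comp measurable_fst).prodMk (hv.comp measurable_snd))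
  have hvm' (y : β) : Measurable fun y' => sqDist (v y) (v y') :=
    hvm.comp (measurable_const.prodMk measurable_id)
  have key : ∀ᵐ x ∂μ, ∀ y, c * sqDist (u x) (v y)
      ≤ 2 * (e x + M * ∫⁻ y', sqDist (v y) (v y') ∂ν) := by
    filter_upwards [hc] with x hx y
    calc c * sqDist (u x) (v y)
        ≤ (∫⁻ y', k x y' ∂ν) * sqDist (u x) (v y) := by gcongr
      _ = ∫⁻ y', k x y' * sqDist (u x) (v y) ∂ν :=
          (lintegral_mul_const _ (hk.comp (measurable_const.prodMk measurable_id))).symm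
      _ ≤ ∫⁻ y', 2 * (k x y' * sqDist (u x) (v y') + M * sqDist (v y) (v y')) ∂ν := by
          refine lintegral_mono fun y' => ?_
          calc k x y' * sqDist (u x) (v y)
              ≤ k x y' * (2 * (sqDist (u x) (v y') + sqDist (v y') (v y))) := by
                gcongr; exact sqDist_le _ _ _
            _ = 2 * (k x y' * sqDist (u x) (v y') + k x y' * sqDist (v y) (v y')) := by
                rw [sqDist_comm (v y) (v y')]; ring
            _ ≤ _ := by gcongr; exact hM x y'
      _ = _ := by
          rw [lintegral_const_mul' _ _ (by simp), lintegral_add_left (hym x),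
            lintegral_const_mul _ (hvm' y)]
  calc c * ∫⁻ x, ∫⁻ y, sqDist (u x) (v y) ∂ν ∂μ
      = ∫⁻ x, ∫⁻ y, c * sqDist (u x) (v y) ∂ν ∂μ := by
        rw [← lintegral_const_mul _ huv.lintegral_prod_right']
        refine lintegral_congr fun x => ?_
        exact (lintegral_const_mul _ (huv.comp (measurable_const.prodMk measurable_id))).symm
    _ ≤ ∫⁻ x, ∫⁻ y, 2 * (e x + M * ∫⁻ y', sqDist (v y) (v y') ∂ν) ∂ν ∂μ := by
        refine lintegral_mono_ae ?_
        filter_upwards [key] with x hx using lintegral_mono hx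
    _ = ∫⁻ x, 2 * (e x * ν Set.univ + M * ∫⁻ y, ∫⁻ y', sqDist (v y) (v y') ∂ν ∂ν) ∂μ := by
        refine lintegral_congr fun y => ?_
        rw [lintegral_const_mul' _ _ (by simp), lintegral_add_left measurable_const,
          lintegral_const, lintegral_const_mul _ hvm.lintegral_prod_right']
    _ = _ := by
        rw [lintegral_const_mul' _ _ (by simp), lintegral_add_left (hem.mul_const _),
          lintegral_mul_const _ hem, lintegral_const]
        ring

theorem lintegral_sqDist_const [IsFiniteMeasure μ] {u : α → ℝ} (hu : MemLp u 2 μ) (t : ℝ) :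
    ∫⁻ x, sqDist (u x) t ∂μ
        = ENNReal.ofReal ((∫ x, u x ^ 2 ∂μ) - 2 * t * (∫ x, u x ∂μ) + t ^ 2 * μ.real Set.univ) ∧
      0 ≤ (∫ x, u x ^ 2 ∂μ) - 2 * t * (∫ x, u x ∂μ) + t ^ 2 * μ.real Set.univ := by
  have h1 : Integrable (fun x => 2 * t * u x) μ := (hu.integrable (by norm_num)).const_mul _
  have h2 : Integrable (fun x => u x ^ 2) μ := hu.integrable_sq
  have h3 : Integrable (fun x => u x ^ 2 - 2 * t * u x) μ := h2.sub h1
  have e : ∫ x, (u x - t) ^ 2 ∂μ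
      = (∫ x, u x ^ 2 ∂μ) - 2 * t * (∫ x, u x ∂μ) + t ^ 2 * μ.real Set.univ := by
    have : (fun x => (u x - t) ^ 2) = fun x => (u x ^ 2 - 2 * t * u x) + t ^ 2 := by
      ext x; ring
    rw [this, integral_add h3 (integrable_const _), integral_sub h2 h1, integral_const_mul,
      integral_const, smul_eq_mul, mul_comm (t ^ 2)]
  rw [← e]
  refine ⟨?_, integral_nonneg fun x => sq_nonneg _⟩
  unfold sqDist
  rw [ofReal_integral_eq_lintegral_ofReal _ (Filter.Eventually.of_forall fun x => sq_nonneg _)]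
  exact (hu.sub (memLp_const t)).integrable_sq

/-- A pair of total mean zero is, in mean square, closest to zero among the constants. -/
theorem ofReal_integral_sq_le_lintegral_sqDist [IsFiniteMeasure μ] [IsFiniteMeasure ν]
    {u : α → ℝ} {v : β → ℝ} (hu : MemLp u 2 μ) (hv : MemLp v 2 ν)
    (h0 : (∫ x, u x ∂μ) + ∫ y, v y ∂ν = 0) (t : ℝ) :
    ENNReal.ofReal ((∫ x, u x ^ 2 ∂μ) + ∫ y, v y ^ 2 ∂ν)
      ≤ (∫⁻ x, sqDist (u x) t ∂μ) + ∫⁻ y, sqDist (v y) t ∂ν := by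
  obtain ⟨e1, p1⟩ := lintegral_sqDist_const hu t
  obtain ⟨e2, p2⟩ := lintegral_sqDist_const hv t
  rw [e1, e2, ← ENNReal.ofReal_add p1 p2]
  apply ENNReal.ofReal_le_ofReal
  have h1 : 0 ≤ t ^ 2 * μ.real Set.univ := by positivity
  have h2 : 0 ≤ t ^ 2 * ν.real Set.univ := by positivity
  -- The two means are opposite, so the terms linear in `t` cancel and only nonnegative multiples of
  -- `t ^ 2` remain.
  have h3 : ∫ x, u x ∂μ = - ∫ y, v y ∂ν := by linarith
  rw [h3]
  nlinarith

/-- A nonlocal Poincaré inequality for pairs of total mean zero. -/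
theorem exists_integral_sq_le_mul_integral_sub_sq [IsFiniteMeasure μ] [IsFiniteMeasure ν]
    (hν : ν ≠ 0) {k : α → β → ℝ} (hk : Measurable (Function.uncurry k))
    (hk0 : ∀ x y, 0 ≤ k x y) {M : ℝ} (hM : ∀ x y, k x y ≤ M) {c c' : ℝ} (hc0 : 0 < c) (hc'0 : 0 < c')
    (hc : ∀ᵐ y ∂ν, ∀ᵐ y' ∂ν, c ≤ ∫ x, min (k x y) (k x y') ∂μ)
    (hc' : ∀ᵐ x ∂μ, c' ≤ ∫ y, k x y ∂ν) :
    ∃ C : ℝ, 0 < C ∧ ∀ (u : α → ℝ) (v : β → ℝ), Measurable u → Measurable v → MemLp u 2 μ →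
      MemLp v 2 ν → (∫ x, u x ∂μ) + ∫ y, v y ∂ν = 0 →
      (∫ x, u x ^ 2 ∂μ) + ∫ y, v y ^ 2 ∂ν
        ≤ C * ∫ p, k p.1 p.2 * (u p.1 - v p.2) ^ 2 ∂(μ.prod ν) := by
  set n := ν.real Set.univ with hn
  set m := μ.real Set.univ with hmdef
  have hnpos : 0 < n := by
    rw [hn, measureReal_def, ENNReal.toReal_pos_iff]
    exact ⟨by simpa [pos_iff_ne_zero] using hν, measure_lt_top _ _⟩
  have hm0 : 0 ≤ m := measureReal_nonneg
  have hν' : ν Set.univ = ENNReal.ofReal n := by simp [hn]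
  have hμ' : μ Set.univ = ENNReal.ofReal m := by simp [hmdef]
  -- With `P`, `Q`, `I`, `a` as below, the estimates are `c P ≤ 4 n I`, `c' Q ≤ 2 (n I + |M| m P)`
  -- and `a n ≤ Q + P`. Multiplying the last by `c c'` and inserting the others gives `c c' n a ≤ K
  -- I`.
  set K := 2 * c * n + 8 * |M| * m * n + 4 * c' * n with hK
  have hKpos : 0 < K := by positivity
  refine ⟨K / (c * c' * n), by positivity, fun u v hu hv hu2 hv2 h0 => ?_⟩
  set κ : α → β → ℝ≥0∞ := fun x y => ENNReal.ofReal (k x y) with hκ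
  have hκm : Measurable (Function.uncurry κ) := ENNReal.measurable_ofReal.comp hk
  have hkx (y : β) : Measurable fun x => k x y := hk.comp (measurable_id.prodMk measurable_const)
  have hky (x : α) : Measurable fun y => k x y := hk.comp (measurable_const.prodMk measurable_id)
  have hc1 : ∀ᵐ y ∂ν, ∀ᵐ y' ∂ν, ENNReal.ofReal c ≤ ∫⁻ x, min (κ x y) (κ x y') ∂μ := by
    filter_upwards [hc] with y hy
    filter_upwards [hy] with y' hy'
    refine (ENNReal.ofReal_le_ofReal hy').trans (le_of_eq ?_)
    rw [ofReal_integral_eq_lintegral_ofReal]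
    · refine lintegral_congr fun x => ?_
      exact ENNReal.ofReal_mono.map_min
    · refine Integrable.of_bound ((hkx y).min (hkx y')).aestronglyMeasurable M
        (Filter.Eventually.of_forall fun x => ?_)
      rw [Real.norm_of_nonneg (le_min (hk0 _ _) (hk0 _ _))]
      exact (min_le_left _ _).trans (hM _ _)
    · exact Filter.Eventually.of_forall fun x => le_min (hk0 _ _) (hk0 _ _)
  have hc2 : ∀ᵐ x ∂μ, ENNReal.ofReal c' ≤ ∫⁻ y, κ x y ∂ν := by
    filter_upwards [hc'] with x hx
    refine (ENNReal.ofReal_le_ofReal hx).trans (le_of_eq ?_)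
    rw [ofReal_integral_eq_lintegral_ofReal]
    · refine Integrable.of_bound (hky x).aestronglyMeasurable M
        (Filter.Eventually.of_forall fun y => ?_)
      rw [Real.norm_of_nonneg (hk0 _ _)]
      exact hM _ _
    · exact Filter.Eventually.of_forall fun y => hk0 _ _
  have hM' : ∀ x y, κ x y ≤ ENNReal.ofReal |M| := fun x y =>
    ENNReal.ofReal_le_ofReal ((hM x y).trans (le_abs_self M))
  have i1 := mul_lintegral_sqDist_snd_le hκm hu hv hc1
  have i2 := mul_lintegral_sqDist_le hκm hu hv hc2 hM'
  set P := ∫⁻ y, ∫⁻ y', sqDist (v y) (v y') ∂ν ∂ν with hP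
  set Q := ∫⁻ x, ∫⁻ y, sqDist (u x) (v y) ∂ν ∂μ with hQ
  have huv : Measurable fun p : α × β => sqDist (u p.1) (v p.2) :=
    measurable_sqDist.comp ((hu.comp measurable_fst).prodMk (hv.comp measurable_snd))
  set I := ∫ p, k p.1 p.2 * (u p.1 - v p.2) ^ 2 ∂(μ.prod ν) with hI
  have hI0 : 0 ≤ I := integral_nonneg fun p => mul_nonneg (hk0 _ _) (sq_nonneg _)
  have hE : ∫⁻ y, ∫⁻ x, κ x y * sqDist (u x) (v y) ∂μ ∂ν = ENNReal.ofReal I := by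
    rw [← lintegral_lintegral_swap (measurable_mul_sqDist hκm hu hv).aemeasurable,
      lintegral_lintegral (measurable_mul_sqDist hκm hu hv).aemeasurable, hI,
      ofReal_integral_eq_lintegral_ofReal]
    · refine lintegral_congr fun p => ?_
      rw [ENNReal.ofReal_mul (hk0 _ _)]; rfl
    · refine Integrable.bdd_mul (c := M) ?_ hk.aestronglyMeasurable ?_
      · exact ((hu2.comp_fst ν).sub (hv2.comp_snd μ)).integrable_sq
      · refine Filter.Eventually.of_forall fun p => ?_
        rw [Real.norm_of_nonneg (hk0 _ _)]
        exact hM _ _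
    · exact Filter.Eventually.of_forall fun p => mul_nonneg (hk0 _ _) (sq_nonneg _)
  rw [hE, hν'] at i1 i2
  rw [hμ'] at i2
  set a := (∫ x, u x ^ 2 ∂μ) + ∫ y, v y ^ 2 ∂ν with ha
  -- The comparison with constants is applied with `t = v y` and integrated over `y`.
  have i3 : ENNReal.ofReal a * ENNReal.ofReal n ≤ Q + P := by
    rw [← hν', ← lintegral_const]
    calc ∫⁻ _, ENNReal.ofReal a ∂ν
        ≤ ∫⁻ y, (∫⁻ x, sqDist (u x) (v y) ∂μ) + ∫⁻ y', sqDist (v y') (v y) ∂ν ∂ν :=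
          lintegral_mono fun y => ofReal_integral_sq_le_lintegral_sqDist hu2 hv2 h0 (v y)
      _ = Q + P := by
          rw [lintegral_add_left huv.lintegral_prod_left', hQ,
            lintegral_lintegral_swap (f := fun x y => sqDist (u x) (v y)) huv.aemeasurable, hP]
          simp_rw [sqDist_comm (v _) (v _)]
  have i4 : ENNReal.ofReal (a * (c * c' * n)) ≤ ENNReal.ofReal (K * I) := by
    have ha0 : 0 ≤ a := add_nonneg (integral_nonneg fun _ => sq_nonneg _)
      (integral_nonneg fun _ => sq_nonneg _)
    calc ENNReal.ofReal (a * (c * c' * n))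
        = ENNReal.ofReal c * ENNReal.ofReal c' * (ENNReal.ofReal a * ENNReal.ofReal n) := by
          rw [← ENNReal.ofReal_mul hc0.le, ← ENNReal.ofReal_mul ha0,
            ← ENNReal.ofReal_mul (by positivity)]
          congr 1; ring
      _ ≤ ENNReal.ofReal c * ENNReal.ofReal c' * (Q + P) := by gcongr
      _ = ENNReal.ofReal c * (ENNReal.ofReal c' * Q) + ENNReal.ofReal c' * (ENNReal.ofReal c * P) := by
          ring
      _ ≤ ENNReal.ofReal c * (2 * (ENNReal.ofReal n * ENNReal.ofReal I
            + ENNReal.ofReal |M| * ENNReal.ofReal m * P))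
          + ENNReal.ofReal c' * (4 * (ENNReal.ofReal n * ENNReal.ofReal I)) := by gcongr
      _ = 2 * ENNReal.ofReal c * (ENNReal.ofReal n * ENNReal.ofReal I)
          + 2 * (ENNReal.ofReal |M| * ENNReal.ofReal m * (ENNReal.ofReal c * P))
          + ENNReal.ofReal c' * (4 * (ENNReal.ofReal n * ENNReal.ofReal I)) := by ring
      _ ≤ 2 * ENNReal.ofReal c * (ENNReal.ofReal n * ENNReal.ofReal I)
          + 2 * (ENNReal.ofReal |M| * ENNReal.ofReal m
            * (4 * (ENNReal.ofReal n * ENNReal.ofReal I)))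
          + ENNReal.ofReal c' * (4 * (ENNReal.ofReal n * ENNReal.ofReal I)) := by gcongr
      _ = ENNReal.ofReal (K * I) := by
          rw [show (2 : ℝ≥0∞) = ENNReal.ofReal 2 by simp,
            show (4 : ℝ≥0∞) = ENNReal.ofReal 4 by simp]
          repeat rw [← ENNReal.ofReal_mul (by positivity)]
          repeat rw [← ENNReal.ofReal_add (by positivity) (by positivity)]
          congr 1
          rw [hK]; ring
  have i5 := (ENNReal.ofReal_le_ofReal_iff (by positivity)).1 i4
  rw [div_mul_eq_mul_div, le_div_iff₀ (by positivity)]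
  exact i5

end Poincare

/-! ### Uniform positivity of the interaction through `J`. -/

section Kernel

variable {N : ℕ} {J : Space N → ℝ}

theorem IsAdmissibleKernel.exists_bound (hJ : IsAdmissibleKernel J) : ∃ M, ∀ z, J z ≤ M := by
  obtain ⟨M, hM⟩ := hJ.hasCompactSupport.exists_bound_of_continuous hJ.continuous
  exact ⟨M, fun z => (le_abs_self _).trans (hM z)⟩

/-- Every difference `x - y` lies in the ball of radius `R`, hence in the closure of `{J ≠ 0}`. So
`J` is positive at points arbitrarily close to `x - y`, and openness of `U` absorbs the
displacement. The closure of `Ω` is allowed for `y` because the compactness argument below needs it.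
-/
theorem IsAdmissibleKernel.exists_mem_pos (hJ : IsAdmissibleKernel J) {Ω U : Set (Space N)} {R : ℝ}
    (hΩ : Bornology.IsBounded Ω) (hR : Metric.diam Ω < R)
    (hJR : Metric.ball (0 : Space N) R ⊆ tsupport J) (hU : IsOpen U) (hUn : U.Nonempty)
    (hUΩ : U ⊆ Ω) {y : Space N} (hy : y ∈ closure Ω) : ∃ x ∈ U, 0 < J (x - y) := by
  obtain ⟨x, hx⟩ := hUn
  have hxy : x - y ∈ tsupport J := by
    apply hJR
    rw [mem_ball_zero_iff, ← dist_eq_norm]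
    calc dist x y ≤ Metric.diam (closure Ω) :=
          Metric.dist_le_diam_of_mem hΩ.closure (subset_closure (hUΩ hx)) hy
      _ = Metric.diam Ω := Metric.diam_closure Ω
      _ < R := hR
  obtain ⟨z, hz, hzJ⟩ := mem_closure_iff.1 hxy ((fun z => z + y) ⁻¹' U)
    (hU.preimage (by fun_prop)) (by simpa using hx)
  refine ⟨z + y, hz, ?_⟩
  rw [add_sub_cancel_right]
  exact lt_of_le_of_ne (hJ.nonneg z) (Ne.symm hzJ)

/-- Any two points of `Ω` interact, uniformly, with a common part of `S ⊆ Ω`. -/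
theorem IsAdmissibleKernel.exists_pos_le_integral_min (hJ : IsAdmissibleKernel J)
    {Ω S : Set (Space N)} {R : ℝ} (hΩ : Bornology.IsBounded Ω) (hR : Metric.diam Ω < R)
    (hJR : Metric.ball (0 : Space N) R ⊆ tsupport J) (hSΩ : S ⊆ Ω) (hS : (interior S).Nonempty)
    [IsFiniteMeasure (volume.restrict S)] :
    ∃ c : ℝ, 0 < c ∧ ∀ y ∈ Ω, ∀ y' ∈ Ω, c ≤ ∫ x in S, min (J (x - y)) (J (x - y')) := by
  obtain ⟨M, hM⟩ := hJ.exists_bound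
  have hJc := hJ.continuous
  have hnn (x y y' : Space N) : 0 ≤ min (J (x - y)) (J (x - y')) :=
    le_min (hJ.nonneg _) (hJ.nonneg _)
  have hbd (x y y' : Space N) : ‖min (J (x - y)) (J (x - y'))‖ ≤ M := by
    rw [Real.norm_of_nonneg (hnn x y y')]
    exact (min_le_left _ _).trans (hM _)
  -- `F` is continuous by dominated convergence, so it attains a minimum on the compact set `closure
  -- Ω ×ˢ closure Ω`; that minimum is the constant, and only its positivity is at stake.
  set F : Space N × Space N → ℝ := fun p => ∫ x in S, min (J (x - p.1)) (J (x - p.2)) with hF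
  have hFc : Continuous F := by
    refine continuous_of_dominated (bound := fun _ => M) (fun p => ?_) (fun p => ?_)
      (integrable_const _) ?_
    · exact Continuous.aestronglyMeasurable (by fun_prop)
    · exact Filter.Eventually.of_forall fun x => hbd x _ _
    · exact Filter.Eventually.of_forall fun x => by fun_prop
  have hΩn : (closure Ω).Nonempty := (hS.mono (interior_subset.trans hSΩ)).closure
  obtain ⟨p, hp, hmin⟩ := (hΩ.isCompact_closure.prod hΩ.isCompact_closure).exists_isMinOn
    (hΩn.prod hΩn) hFc.continuousOn
  refine ⟨F p, ?_, fun y hy y' hy' => hmin (Set.mk_mem_prod (subset_closure hy)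
    (subset_closure hy'))⟩
  -- `exists_mem_pos` is used twice: first in `interior S` for `p.1`, then for `p.2` in the open set
  -- just shown to be nonempty. Both kernels are thus positive on a common nonempty open subset of
  -- `S`.
  obtain ⟨x₁, hx₁, hx₁J⟩ := hJ.exists_mem_pos hΩ hR hJR isOpen_interior hS
    (interior_subset.trans hSΩ) hp.1
  have hV : IsOpen (interior S ∩ {x | 0 < J (x - p.1)}) :=
    isOpen_interior.inter (isOpen_lt continuous_const (by fun_prop))
  obtain ⟨x₂, hx₂, hx₂J⟩ := hJ.exists_mem_pos hΩ hR hJR hV ⟨x₁, hx₁, hx₁J⟩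
    ((Set.inter_subset_left.trans interior_subset).trans hSΩ) hp.2
  have hV' : IsOpen ((interior S ∩ {x | 0 < J (x - p.1)}) ∩ {x | 0 < J (x - p.2)}) :=
    hV.inter (isOpen_lt continuous_const (by fun_prop))
  have hint : IntegrableOn (fun x => min (J (x - p.1)) (J (x - p.2))) S :=
    Integrable.of_bound (Continuous.aestronglyMeasurable (by fun_prop)) M
      (Filter.Eventually.of_forall fun x => hbd x _ _)
  refine (setIntegral_pos_iff_support_of_nonneg_ae
    (Filter.Eventually.of_forall fun x => hnn x _ _) hint).2 ?_
  refine (hV'.measure_pos volume ⟨x₂, hx₂, hx₂J⟩).trans_le (measure_mono ?_)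
  rintro x ⟨⟨hxS, h1⟩, h2⟩
  exact ⟨(lt_min h1 h2).ne', interior_subset hxS⟩

end Kernel

/-! ### Uniqueness, closedness and constants for the weak gradient. -/

section WeakGradient

variable {N : ℕ} {A : Set (Space N)}

/-- The fundamental lemma of the calculus of variations gives equality a.e. on `interior A`; the
rest of `A` is null. This makes the choice in `weakGrad` harmless. -/
theorem HasWeakGrad.unique [IsFiniteMeasure (volume.restrict A)] (hA : MeasurableSet A)
    (hAnull : volume (A \ interior A) = 0)
    {u : L2 A} {g g' : L2Vec A} (h : HasWeakGrad u g) (h' : HasWeakGrad u g') : g = g' := by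
  have key : ∀ i : Fin N, ∀ᵐ x, x ∈ interior A → g x i - g' x i = 0 := by
    intro i
    have hgi : MemLp (fun x => g x i - g' x i) 2 (volume.restrict A) :=
      (memLp_coord g i).sub (memLp_coord g' i)
    refine isOpen_interior.ae_eq_zero_of_integral_contDiff_smul_eq_zero ?_ ?_
    · have h1 : IntegrableOn (fun x => g x i - g' x i) A := hgi.integrable (by norm_num)
      exact (h1.mono_set interior_subset).locallyIntegrableOn
    · intro φ hφ hc hs
      have hφ2 := memLp_test (A := A) hφ.continuous hc
      have e : ∫ x in A, (g x i * φ x - g' x i * φ x) = 0 := by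
        have := (h φ hφ hc hs i).symm.trans (h' φ hφ hc hs i)
        have i1 : Integrable (fun x => g x i * φ x) (volume.restrict A) :=
          (memLp_coord g i).integrable_mul hφ2
        have i2 : Integrable (fun x => g' x i * φ x) (volume.restrict A) :=
          (memLp_coord g' i).integrable_mul hφ2
        rw [integral_sub i1 i2]
        linarith
      rw [← setIntegral_eq_integral_of_forall_compl_eq_zero (s := A), ← e]
      · refine integral_congr_ae (Filter.Eventually.of_forall fun x => ?_)
        simp only [smul_eq_mul]
        ring
      · intro x hx
        have : φ x = 0 := by
          by_contra hne
          exact hx (interior_subset (hs (subset_tsupport _ hne)))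
        simp [this]
  have hint : ∀ᵐ x, x ∈ A → x ∈ interior A := by
    rw [ae_iff]
    refine measure_mono_null (fun x hx => ?_) hAnull
    simpa using hx
  refine Lp.ext ?_
  rw [Filter.EventuallyEq, ae_restrict_iff' hA]
  filter_upwards [ae_all_iff.2 key, hint] with x hx hxi hxA
  ext i
  exact sub_eq_zero.1 (hx i (hxi hxA))

theorem HasWeakGrad.weakGrad_eq [IsFiniteMeasure (volume.restrict A)] (hA : MeasurableSet A)
    (hAnull : volume (A \ interior A) = 0) {u : L2 A} {g : L2Vec A} (h : HasWeakGrad u g) :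
    weakGrad u = g := by
  have hex : ∃ g : L2Vec A, HasWeakGrad u g := ⟨g, h⟩
  rw [weakGrad, dif_pos hex]
  exact hex.choose_spec.unique hA hAnull h

theorem hasWeakGrad_weakGrad {u : L2 A} (hu : u ∈ H1 A) : HasWeakGrad u (weakGrad u) := by
  have hex : ∃ g : L2Vec A, HasWeakGrad u g := hu
  rw [weakGrad, dif_pos hex]
  exact hex.choose_spec

theorem continuous_integral_mul {μ : Measure (Space N)} {ψ : Space N → ℝ} (hψ : MemLp ψ 2 μ) :
    Continuous fun u : Lp ℝ 2 μ => ∫ x, u x * ψ x ∂μ := by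
  have : (fun u : Lp ℝ 2 μ => ∫ x, u x * ψ x ∂μ) = fun u => inner ℝ (hψ.toLp ψ) u := by
    ext u
    rw [L2.inner_def]
    refine integral_congr_ae ?_
    filter_upwards [hψ.coeFn_toLp] with x hx
    simp [hx]
  rw [this]
  fun_prop

/-- For a fixed test function and coordinate, integration by parts equates two continuous functions
of `(u, g)`, so the graph is an intersection of closed sets. -/
theorem isClosed_hasWeakGrad : IsClosed {p : L2 A × L2Vec A | HasWeakGrad p.1 p.2} := by
  simp only [HasWeakGrad, Set.ofPred_forall]
  refine isClosed_iInter fun φ => isClosed_iInter fun hφ => isClosed_iInter fun hc =>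
    isClosed_iInter fun _ => isClosed_iInter fun i => isClosed_eq ?_ ?_
  · exact (continuous_integral_mul (memLp_partialDeriv hφ hc i)).comp continuous_fst
  · refine Continuous.neg ?_
    have hproj : Continuous fun p : L2 A × L2Vec A =>
        (EuclideanSpace.proj (𝕜 := ℝ) i : Space N →L[ℝ] ℝ).compLpL 2 (volume.restrict A) p.2 :=
      (ContinuousLinearMap.continuous _).comp continuous_snd
    have hcont := (continuous_integral_mul (memLp_test (A := A) hφ.continuous hc)).comp hproj
    refine hcont.congr fun p => integral_congr_ae ?_
    filter_upwards [ContinuousLinearMap.coeFn_compLpL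
      (EuclideanSpace.proj (𝕜 := ℝ) i : Space N →L[ℝ] ℝ) p.2] with x hx
    rw [hx]
    rfl

/-- The partial derivatives of a test function have integral zero over the whole space and vanish
outside `A`. -/
theorem hasWeakGrad_const [IsFiniteMeasure (volume.restrict A)] (c : ℝ) :
    HasWeakGrad (Lp.const 2 (volume.restrict A) c : L2 A) (0 : L2Vec A) := by
  intro φ hφ hc hs i
  have h2 : ∫ x in A, (0 : L2Vec A) x i * φ x = 0 := by
    refine integral_eq_zero_of_ae ?_
    filter_upwards [Lp.coeFn_zero (Space N) 2 (volume.restrict A)] with x hx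
    rw [hx]; simp
  have hd : Continuous (partialDeriv i φ) :=
    (hφ.continuous_fderiv (by simp)).clm_apply continuous_const
  have hdc : HasCompactSupport (partialDeriv i φ) := hc.fderiv_apply (𝕜 := ℝ) _
  have h3 : ∫ x, partialDeriv i φ x = 0 := by
    have := integral_mul_fderiv_eq_neg_fderiv_mul_of_integrable (μ := (volume : Measure (Space N)))
      (f := fun _ => (1 : ℝ)) (g := φ) (v := EuclideanSpace.single i 1)
      (by simp) (by simp only [one_mul]; exact hd.integrable_of_hasCompactSupport hdc)
      (by simpa using hφ.continuous.integrable_of_hasCompactSupport hc)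
      (fun x _ => by fun_prop) (fun x _ => (hφ.differentiable (by simp)) x)
    simpa [partialDeriv] using this
  rw [h2, neg_zero]
  have h1 : ∫ x in A, (Lp.const 2 (volume.restrict A) c : L2 A) x * partialDeriv i φ x
      = ∫ x in A, c * partialDeriv i φ x := by
    refine integral_congr_ae ?_
    filter_upwards [Lp.coeFn_const (p := 2) (μ := volume.restrict A) c] with x hx
    rw [hx]; rfl
  rw [h1, integral_const_mul, setIntegral_eq_integral_of_forall_compl_eq_zero, h3, mul_zero]
  intro x hx
  by_contra hne
  have hx' : x ∈ tsupport φ := by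
    by_contra hxt
    have h0 : φ =ᶠ[nhds x] fun _ => 0 := notMem_tsupport_iff_eventuallyEq.1 hxt
    apply hne
    rw [partialDeriv, h0.fderiv_eq]
    simp
  exact hx (interior_subset (hs hx'))

end WeakGradient

/-! ### Nonlocal terms as inner products in `L²` of the product. -/

section Interaction

variable {α β : Type*} [MeasurableSpace α] [MeasurableSpace β] {μ : Measure α} {ν : Measure β}
  [IsFiniteMeasure μ] [IsFiniteMeasure ν]

theorem memLp_sub_prod (w : Lp ℝ 2 μ × Lp ℝ 2 ν) :
    MemLp (fun p : α × β => w.1 p.1 - w.2 p.2) 2 (μ.prod ν) :=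
  ((Lp.memLp w.1).comp_fst ν).sub ((Lp.memLp w.2).comp_snd μ)

/-- Sharing the kernel as `√k * √k` between the two arguments turns the nonlocal form into `⟪T w, T
t⟫`. Symmetry and nonnegativity are then automatic, and boundedness of the form reduces to that of
`T`. -/
theorem memLp_sqrt_mul_sub {k : α × β → ℝ} (hk : Measurable k) {M : ℝ} (hM : ∀ p, k p ≤ M)
    (w : Lp ℝ 2 μ × Lp ℝ 2 ν) :
    MemLp (fun p : α × β => √(k p) * (w.1 p.1 - w.2 p.2)) 2 (μ.prod ν) := by
  have h1 : MemLp (fun p => √(k p)) ⊤ (μ.prod ν) := by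
    refine memLp_top_of_bound hk.sqrt.aestronglyMeasurable (√M)
      (Filter.Eventually.of_forall fun p => ?_)
    rw [Real.norm_of_nonneg (Real.sqrt_nonneg _)]
    exact Real.sqrt_le_sqrt (hM p)
  exact (memLp_sub_prod w).mul h1

theorem integral_sub_prod_sq_le (w : Lp ℝ 2 μ × Lp ℝ 2 ν) :
    ∫ p, (w.1 p.1 - w.2 p.2) ^ 2 ∂(μ.prod ν)
      ≤ 2 * (ν.real Set.univ * ‖w.1‖ ^ 2 + μ.real Set.univ * ‖w.2‖ ^ 2) := by
  have i1 : Integrable (fun p : α × β => w.1 p.1 ^ 2) (μ.prod ν) :=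
    ((Lp.memLp w.1).comp_fst ν).integrable_sq
  have i2 : Integrable (fun p : α × β => w.2 p.2 ^ 2) (μ.prod ν) :=
    ((Lp.memLp w.2).comp_snd μ).integrable_sq
  have e1 : ‖w.1‖ ^ 2 = ∫ x, w.1 x ^ 2 ∂μ := by
    rw [← real_inner_self_eq_norm_sq, L2.inner_def]
    simp [sq]
  have e2 : ‖w.2‖ ^ 2 = ∫ y, w.2 y ^ 2 ∂ν := by
    rw [← real_inner_self_eq_norm_sq, L2.inner_def]
    simp [sq]
  calc ∫ p, (w.1 p.1 - w.2 p.2) ^ 2 ∂(μ.prod ν)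
      ≤ ∫ p, 2 * (w.1 p.1 ^ 2 + w.2 p.2 ^ 2) ∂(μ.prod ν) := by
        refine integral_mono (memLp_sub_prod w).integrable_sq ((i1.add i2).const_mul 2) fun p => ?_
        change (w.1 p.1 - w.2 p.2) ^ 2 ≤ 2 * (w.1 p.1 ^ 2 + w.2 p.2 ^ 2)
        nlinarith [sq_nonneg (w.1 p.1 + w.2 p.2)]
    _ = _ := by
        rw [integral_const_mul, integral_add i1 i2, e1, e2,
          integral_fun_fst (fun x => w.1 x ^ 2), integral_fun_snd (fun y => w.2 y ^ 2)]
        simp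

/-- The map `(u, v) ↦ √k(x, y) (u(x) - v(y))` into `L²` of the product. -/
noncomputable def interactionLinear {k : α × β → ℝ} (hk : Measurable k) {M : ℝ}
    (hM : ∀ p, k p ≤ M) : (Lp ℝ 2 μ × Lp ℝ 2 ν) →ₗ[ℝ] Lp ℝ 2 (μ.prod ν) where
  toFun w := (memLp_sqrt_mul_sub hk hM w).toLp _
  map_add' w t := by
    rw [← MemLp.toLp_add, MemLp.toLp_eq_toLp_iff]
    filter_upwards [Measure.quasiMeasurePreserving_fst.ae_eq_comp (Lp.coeFn_add w.1 t.1),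
      Measure.quasiMeasurePreserving_snd.ae_eq_comp (Lp.coeFn_add w.2 t.2)] with p h1 h2
    simp only [Function.comp_apply, Pi.add_apply] at h1 h2
    simp only [Pi.add_apply, Prod.fst_add, Prod.snd_add, h1, h2]
    ring
  map_smul' c w := by
    rw [RingHom.id_apply, ← MemLp.toLp_const_smul, MemLp.toLp_eq_toLp_iff]
    filter_upwards [Measure.quasiMeasurePreserving_fst.ae_eq_comp (Lp.coeFn_smul c w.1),
      Measure.quasiMeasurePreserving_snd.ae_eq_comp (Lp.coeFn_smul c w.2)] with p h1 h2
    simp only [Function.comp_apply, Pi.smul_apply, smul_eq_mul] at h1 h2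
    simp only [Pi.smul_apply, Prod.smul_fst, Prod.smul_snd, h1, h2, smul_eq_mul]
    ring

theorem inner_interactionLinear {k : α × β → ℝ} (hk : Measurable k) {M : ℝ}
    (hM : ∀ p, k p ≤ M) (hk0 : ∀ p, 0 ≤ k p) (w t : Lp ℝ 2 μ × Lp ℝ 2 ν) :
    inner ℝ (interactionLinear hk hM w) (interactionLinear hk hM t)
      = ∫ p, k p * (w.1 p.1 - w.2 p.2) * (t.1 p.1 - t.2 p.2) ∂(μ.prod ν) := by
  rw [L2.inner_def]
  refine integral_congr_ae ?_
  filter_upwards [(memLp_sqrt_mul_sub hk hM w).coeFn_toLp,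
    (memLp_sqrt_mul_sub hk hM t).coeFn_toLp] with p h1 h2
  simp only [interactionLinear, LinearMap.coe_mk, AddHom.coe_mk]
  rw [h1, h2]
  simp only [RCLike.inner_apply, conj_trivial]
  linear_combination (w.1 p.1 - w.2 p.2) * (t.1 p.1 - t.2 p.2) * Real.mul_self_sqrt (hk0 p)

theorem norm_interactionLinear_le {k : α × β → ℝ} (hk : Measurable k) {M : ℝ}
    (hM : ∀ p, k p ≤ M) (hk0 : ∀ p, 0 ≤ k p) (w : Lp ℝ 2 μ × Lp ℝ 2 ν) :
    ‖interactionLinear hk hM w‖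
      ≤ √(2 * |M| * (μ.real Set.univ + ν.real Set.univ)) * ‖w‖ := by
  refine abs_le_of_sq_le_sq' ?_ (by positivity) |>.2
  rw [mul_pow, Real.sq_sqrt (by positivity), ← real_inner_self_eq_norm_sq,
    inner_interactionLinear hk hM hk0]
  have hsq := (memLp_sub_prod w).integrable_sq
  calc ∫ p, k p * (w.1 p.1 - w.2 p.2) * (w.1 p.1 - w.2 p.2) ∂(μ.prod ν)
      ≤ ∫ p, |M| * (w.1 p.1 - w.2 p.2) ^ 2 ∂(μ.prod ν) := by
        refine integral_mono_of_nonneg (Filter.Eventually.of_forall fun p => ?_)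
          (hsq.const_mul _) (Filter.Eventually.of_forall fun p => ?_)
        · change 0 ≤ k p * (w.1 p.1 - w.2 p.2) * (w.1 p.1 - w.2 p.2)
          rw [mul_assoc]
          exact mul_nonneg (hk0 p) (mul_self_nonneg _)
        · change k p * (w.1 p.1 - w.2 p.2) * (w.1 p.1 - w.2 p.2)
            ≤ |M| * (w.1 p.1 - w.2 p.2) ^ 2
          rw [mul_assoc, ← sq]
          exact mul_le_mul_of_nonneg_right ((hM p).trans (le_abs_self M)) (sq_nonneg _)
    _ = |M| * ∫ p, (w.1 p.1 - w.2 p.2) ^ 2 ∂(μ.prod ν) := integral_const_mul _ _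
    _ ≤ |M| * (2 * (ν.real Set.univ * ‖w‖ ^ 2 + μ.real Set.univ * ‖w‖ ^ 2)) := by
        refine mul_le_mul_of_nonneg_left ((integral_sub_prod_sq_le w).trans ?_) (abs_nonneg M)
        gcongr
        · exact norm_fst_le w
        · exact norm_snd_le w
    _ = _ := by ring

/-- The map `(u, v) ↦ √k(x, y) (u(x) - v(y))` as a continuous linear map. -/
noncomputable def interaction {k : α × β → ℝ} (hk : Measurable k) {M : ℝ}
    (hM : ∀ p, k p ≤ M) (hk0 : ∀ p, 0 ≤ k p) :
    (Lp ℝ 2 μ × Lp ℝ 2 ν) →L[ℝ] Lp ℝ 2 (μ.prod ν) :=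
  (interactionLinear hk hM).mkContinuous _ (norm_interactionLinear_le hk hM hk0)

theorem inner_interaction {k : α × β → ℝ} (hk : Measurable k) {M : ℝ}
    (hM : ∀ p, k p ≤ M) (hk0 : ∀ p, 0 ≤ k p) (w t : Lp ℝ 2 μ × Lp ℝ 2 ν) :
    inner ℝ (interaction hk hM hk0 w) (interaction hk hM hk0 t)
      = ∫ p, k p * (w.1 p.1 - w.2 p.2) * (t.1 p.1 - t.2 p.2) ∂(μ.prod ν) :=
  inner_interactionLinear hk hM hk0 w t

end Interaction

/-! ### The Hilbert space of triples and its closed subspace. -/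

section Forms

/-- The bounded bilinear form `⟪S x, S y⟫` of a bounded operator `S`. -/
noncomputable def gramForm {E F : Type*} [NormedAddCommGroup E] [NormedSpace ℝ E]
    [NormedAddCommGroup F] [InnerProductSpace ℝ F] (S : E →L[ℝ] F) : E →L[ℝ] E →L[ℝ] ℝ :=
  ContinuousLinearMap.bilinearComp (innerSL ℝ) S S

variable {N : ℕ} (A B : Set (Space N))

/-- Triples `(u, v, g)` in `L²(A) × L²(B) × L²(A; ℝ^N)`, as a Hilbert space. -/
abbrev Triples : Type := WithLp 2 (WithLp 2 (L2 A × L2 B) × L2Vec A)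

/-- The pair `(u, v)` of a triple `(u, v, g)`. -/
noncomputable def pairL : Triples A B →L[ℝ] L2 A × L2 B :=
  (WithLp.prodContinuousLinearEquiv 2 ℝ (L2 A) (L2 B)).toContinuousLinearMap ∘L
    ContinuousLinearMap.fst ℝ _ _ ∘L
    (WithLp.prodContinuousLinearEquiv 2 ℝ (WithLp 2 (L2 A × L2 B)) (L2Vec A)).toContinuousLinearMap

/-- The component `g` of a triple `(u, v, g)`. -/
noncomputable def gradL : Triples A B →L[ℝ] L2Vec A :=
  ContinuousLinearMap.snd ℝ _ _ ∘L
    (WithLp.prodContinuousLinearEquiv 2 ℝ (WithLp 2 (L2 A × L2 B)) (L2Vec A)).toContinuousLinearMap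

variable {A B}

/-- This splits coercivity into a Poincaré part for `(u, v)` and the gradient term. -/
theorem norm_sq_triple (x : Triples A B) :
    ‖x‖ ^ 2 = ‖(pairL A B x).1‖ ^ 2 + ‖(pairL A B x).2‖ ^ 2 + ‖gradL A B x‖ ^ 2 := by
  rw [WithLp.prod_norm_sq_eq_of_L2, WithLp.prod_norm_sq_eq_of_L2]
  rfl

theorem continuous_integral [IsFiniteMeasure (volume.restrict A)] :
    Continuous fun u : L2 A => ∫ x in A, u x := by
  refine (continuous_integral_mul (memLp_const (1 : ℝ))).congr fun u => ?_
  simp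

theorem integral_L2_add [IsFiniteMeasure (volume.restrict A)] (u u' : L2 A) :
    ∫ x in A, (u + u') x = (∫ x in A, u x) + ∫ x in A, u' x := by
  rw [← integral_add ((Lp.memLp u).integrable (by norm_num))
    ((Lp.memLp u').integrable (by norm_num))]
  exact integral_congr_ae (Lp.coeFn_add u u')

theorem integral_L2_smul (c : ℝ) (u : L2 A) : ∫ x in A, (c • u) x = c * ∫ x in A, u x := by
  rw [← integral_const_mul]
  exact integral_congr_ae (Lp.coeFn_smul c u)

variable [IsFiniteMeasure (volume.restrict A)] [IsFiniteMeasure (volume.restrict B)]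

variable (A B) in
/-- The triples `(u, v, ∇u)` with `(u, v) ∈ W`. -/
def meanZeroGraph : Submodule ℝ (Triples A B) where
  carrier := {x | HasWeakGrad (pairL A B x).1 (gradL A B x) ∧
    (∫ y in A, (pairL A B x).1 y) + ∫ y in B, (pairL A B x).2 y = 0}
  zero_mem' := by
    refine ⟨by simpa using HasWeakGrad.zero, ?_⟩
    have h1 := integral_L2_smul (0 : ℝ) (0 : L2 A)
    have h2 := integral_L2_smul (0 : ℝ) (0 : L2 B)
    simp only [smul_zero, zero_mul] at h1 h2
    simp only [map_zero, Prod.fst_zero, Prod.snd_zero, h1, h2, add_zero]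
  add_mem' := by
    rintro x y ⟨hx, hx0⟩ ⟨hy, hy0⟩
    refine ⟨by simpa using hx.add hy, ?_⟩
    simp only [map_add, Prod.fst_add, Prod.snd_add, integral_L2_add]
    linarith
  smul_mem' := by
    rintro c x ⟨hx, hx0⟩
    refine ⟨by simpa using hx.smul c, ?_⟩
    simp only [map_smul, Prod.smul_fst, Prod.smul_snd, integral_L2_smul]
    rw [← mul_add, hx0, mul_zero]

theorem isClosed_meanZeroGraph : IsClosed (meanZeroGraph A B : Set (Triples A B)) := by
  have h1 : Continuous fun x : Triples A B => ((pairL A B x).1, gradL A B x) := by fun_prop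
  have h2 : Continuous fun x : Triples A B => ∫ y in A, (pairL A B x).1 y :=
    continuous_integral.comp (by fun_prop : Continuous fun x : Triples A B => (pairL A B x).1)
  have h3 : Continuous fun x : Triples A B => ∫ y in B, (pairL A B x).2 y :=
    continuous_integral.comp (by fun_prop : Continuous fun x : Triples A B => (pairL A B x).2)
  exact (isClosed_hasWeakGrad.preimage h1).inter (isClosed_eq (h2.add h3) continuous_const)

end Forms

/-! ### Passage between pairs in `W` and triples. -/

section Lift

variable {N : ℕ} {A B : Set (Space N)}

/-- The triple `(u, v, ∇u)` of a pair `(u, v)`. -/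
noncomputable def lift (w : L2 A × L2 B) : Triples A B :=
  WithLp.toLp 2 (WithLp.toLp 2 w, weakGrad w.1)

@[simp] theorem pairL_lift (w : L2 A × L2 B) : pairL A B (lift w) = w := rfl

@[simp] theorem gradL_lift (w : L2 A × L2 B) : gradL A B (lift w) = weakGrad w.1 := rfl

theorem triple_ext {x y : Triples A B} (h : pairL A B x = pairL A B y)
    (h' : gradL A B x = gradL A B y) : x = y := by
  rw [← sub_eq_zero, ← norm_eq_zero, ← sq_eq_zero_iff, norm_sq_triple]
  simp [h, h']

/-- Additivity is not formal, since `weakGrad` is defined by choice; it comes from uniqueness of the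
weak gradient. -/
theorem lift_add [IsFiniteMeasure (volume.restrict A)]
    (hA : MeasurableSet A) (hAnull : volume (A \ interior A) = 0)
    {w t : L2 A × L2 B} (hw : w.1 ∈ H1 A) (ht : t.1 ∈ H1 A) :
    lift (w + t) = lift w + lift t := by
  refine triple_ext (by simp) ?_
  rw [map_add, gradL_lift, gradL_lift, gradL_lift]
  exact ((hasWeakGrad_weakGrad hw).add (hasWeakGrad_weakGrad ht)).weakGrad_eq hA hAnull

variable [IsFiniteMeasure (volume.restrict A)] [IsFiniteMeasure (volume.restrict B)]

theorem lift_mem_meanZeroGraph {w : L2 A × L2 B} (hw : w ∈ W A B) :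
    lift w ∈ meanZeroGraph A B :=
  ⟨hasWeakGrad_weakGrad hw.1, hw.2⟩

theorem pairL_mem_W {x : Triples A B} (hx : x ∈ meanZeroGraph A B) : pairL A B x ∈ W A B :=
  ⟨⟨_, hx.1⟩, hx.2⟩

/-- With `pairL_lift`, this identifies `W` with `meanZeroGraph A B`, so a solution found among
triples is a solution in `W`. -/
theorem lift_pairL (hA : MeasurableSet A) (hAnull : volume (A \ interior A) = 0)
    {x : Triples A B} (hx : x ∈ meanZeroGraph A B) : lift (pairL A B x) = x :=
  triple_ext rfl (hx.1.weakGrad_eq hA hAnull)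

theorem W_sub {w t : L2 A × L2 B} (hw : w ∈ W A B) (ht : t ∈ W A B) : w - t ∈ W A B := by
  have := pairL_mem_W (sub_mem (lift_mem_meanZeroGraph hw) (lift_mem_meanZeroGraph ht))
  simpa using this

end Lift

/-- The Lax-Milgram theorem on a closed subspace. -/
theorem exists_forall_eq_neg_of_coercive {E : Type*} [NormedAddCommGroup E]
    [InnerProductSpace ℝ E] [CompleteSpace E] {V : Submodule ℝ E} (hV : IsClosed (V : Set E))
    (a : E →L[ℝ] E →L[ℝ] ℝ) (l : E →L[ℝ] ℝ) {c : ℝ} (hc : 0 < c)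
    (ha : ∀ x ∈ V, c * ‖x‖ ^ 2 ≤ a x x) : ∃ z ∈ V, ∀ y ∈ V, a z y = - l y := by
  have : CompleteSpace V := hV.completeSpace_coe
  have hcoer : IsCoercive (a.bilinearComp V.subtypeL V.subtypeL) := by
    refine ⟨c, hc, fun x => ?_⟩
    rw [mul_assoc, ← sq]
    exact ha x x.2
  -- The solution is the inverse of the operator of the restricted form, applied to the Riesz
  -- representative of `-l` on `V`.
  set z := hcoer.continuousLinearEquivOfBilin.symm
    ((InnerProductSpace.toDual ℝ V).symm (-(l ∘L V.subtypeL))) with hz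
  refine ⟨z, z.2, fun y hy => ?_⟩
  have h1 := hcoer.continuousLinearEquivOfBilin_apply z ⟨y, hy⟩
  rw [hz, ContinuousLinearEquiv.apply_symm_apply, InnerProductSpace.toDual_symm_apply] at h1
  exact h1.symm

/-! ### The form, the load, the Poincaré inequality and constant pairs. -/

section Form

variable {N : ℕ} {A B : Set (Space N)} {J G : Space N → ℝ}

theorem norm_sq_L2 (u : L2 A) : ‖u‖ ^ 2 = ∫ x in A, u x ^ 2 := by
  rw [← real_inner_self_eq_norm_sq, L2.inner_def]
  simp [sq]

variable (A B) in
theorem exists_linear_eq_load {f : Space N → ℝ} (hfA : MemLp f 2 (volume.restrict A))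
    (hfB : MemLp f 2 (volume.restrict B)) :
    ∃ l : Triples A B →L[ℝ] ℝ, ∀ t : L2 A × L2 B, load f t = l (lift t) := by
  refine ⟨innerSL ℝ (hfA.toLp f) ∘L ContinuousLinearMap.fst ℝ _ _ ∘L pairL A B
    + innerSL ℝ (hfB.toLp f) ∘L ContinuousLinearMap.snd ℝ _ _ ∘L pairL A B, fun t => ?_⟩
  change load f t = inner ℝ (hfA.toLp f) t.1 + inner ℝ (hfB.toLp f) t.2
  rw [L2.inner_def, L2.inner_def, load]
  congr 1
  · refine integral_congr_ae ?_
    filter_upwards [hfA.coeFn_toLp] with x hx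
    simp [hx, mul_comm]
  · refine integral_congr_ae ?_
    filter_upwards [hfB.coeFn_toLp] with x hx
    simp [hx, mul_comm]

theorem energy_eq (f : Space N → ℝ) (w : L2 A × L2 B) :
    energy J G f w = 1 / 2 * form J G w w + load f w := by
  have h1 : ∫ x in A, ‖weakGrad w.1 x‖ ^ 2
      = ∫ x in A, inner ℝ (weakGrad w.1 x) (weakGrad w.1 x) := by
    simp only [real_inner_self_eq_norm_sq]
  have h2 : ∫ p in B ×ˢ B, G (p.1 - p.2) * (w.2 p.2 - w.2 p.1) ^ 2
      = ∫ p in B ×ˢ B, G (p.1 - p.2) * (w.2 p.2 - w.2 p.1) * (w.2 p.2 - w.2 p.1) := by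
    simp only [sq, mul_assoc]
  have h3 : ∫ p in A ×ˢ B, J (p.1 - p.2) * (w.2 p.2 - w.1 p.1) ^ 2
      = ∫ p in A ×ˢ B, J (p.1 - p.2) * (w.1 p.1 - w.2 p.2) * (w.1 p.1 - w.2 p.2) := by
    refine integral_congr_ae (Filter.Eventually.of_forall fun p => ?_)
    change J (p.1 - p.2) * (w.2 p.2 - w.1 p.1) ^ 2
      = J (p.1 - p.2) * (w.1 p.1 - w.2 p.2) * (w.1 p.1 - w.2 p.2)
    ring
  rw [energy, form, load, h1, h2, h3]
  ring

variable [IsFiniteMeasure (volume.restrict A)] [IsFiniteMeasure (volume.restrict B)]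

variable (A B) in
/-- The form of the system is a bounded symmetric bilinear form on triples. -/
theorem exists_bilinear_eq_form (hJ : IsAdmissibleKernel J) (hG : IsAdmissibleKernel G) :
    ∃ a : Triples A B →L[ℝ] Triples A B →L[ℝ] ℝ,
      (∀ w t : L2 A × L2 B, form J G w t = a (lift w) (lift t)) ∧
      (∀ x y, a x y = a y x) ∧
      ∀ x, ‖gradL A B x‖ ^ 2
        + ∫ p, J (p.1 - p.2) * ((pairL A B x).1 p.1 - (pairL A B x).2 p.2) ^ 2
            ∂((volume.restrict A).prod (volume.restrict B)) ≤ a x x := by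
  obtain ⟨M, hM⟩ := hJ.exists_bound
  obtain ⟨M', hM'⟩ := hG.exists_bound
  have hJm : Measurable fun p : Space N × Space N => J (p.1 - p.2) :=
    hJ.continuous.measurable.comp (measurable_fst.sub measurable_snd)
  have hGm : Measurable fun p : Space N × Space N => G (p.1 - p.2) :=
    hG.continuous.measurable.comp (measurable_fst.sub measurable_snd)
  obtain ⟨TJ, hTJ⟩ : ∃ T : (L2 A × L2 B) →L[ℝ]
      Lp ℝ 2 ((volume.restrict A).prod (volume.restrict B)),
      ∀ w t, inner ℝ (T w) (T t) = ∫ p, J (p.1 - p.2) * (w.1 p.1 - w.2 p.2) *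
        (t.1 p.1 - t.2 p.2) ∂((volume.restrict A).prod (volume.restrict B)) :=
    ⟨_, inner_interaction hJm (fun p => hM _) (fun p => hJ.nonneg _)⟩
  obtain ⟨TG, hTG⟩ : ∃ T : (L2 B × L2 B) →L[ℝ]
      Lp ℝ 2 ((volume.restrict B).prod (volume.restrict B)),
      ∀ w t, inner ℝ (T w) (T t) = ∫ p, G (p.1 - p.2) * (w.1 p.1 - w.2 p.2) *
        (t.1 p.1 - t.2 p.2) ∂((volume.restrict B).prod (volume.restrict B)) :=
    ⟨_, inner_interaction hGm (fun p => hM' _) (fun p => hG.nonneg _)⟩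
  let sndL : Triples A B →L[ℝ] L2 B := ContinuousLinearMap.snd ℝ _ _ ∘L pairL A B
  obtain ⟨a, ha⟩ : ∃ a : Triples A B →L[ℝ] Triples A B →L[ℝ] ℝ, ∀ x y,
      a x y = inner ℝ (gradL A B x) (gradL A B y)
        + 1 / 2 * inner ℝ (TG ((pairL A B x).2, (pairL A B x).2))
            (TG ((pairL A B y).2, (pairL A B y).2))
        + inner ℝ (TJ (pairL A B x)) (TJ (pairL A B y)) :=
    ⟨gramForm (gradL A B) + (1 / 2 : ℝ) • gramForm (TG ∘L sndL.prod sndL)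
      + gramForm (TJ ∘L pairL A B), fun x y => rfl⟩
  refine ⟨a, fun w t => ?_, fun x y => ?_, fun x => ?_⟩
  · rw [ha, hTJ, hTG, L2.inner_def, form, Measure.volume_eq_prod, Measure.prod_restrict,
      Measure.prod_restrict]
    simp only [pairL_lift, gradL_lift]
    congr 3
    refine integral_congr_ae (Filter.Eventually.of_forall fun p => ?_)
    change G (p.1 - p.2) * (w.2 p.2 - w.2 p.1) * (t.2 p.2 - t.2 p.1)
      = G (p.1 - p.2) * (w.2 p.1 - w.2 p.2) * (t.2 p.1 - t.2 p.2)
    ring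
  · rw [ha, ha, real_inner_comm (gradL A B x), real_inner_comm (TG _), real_inner_comm (TJ _)]
  · have e : ∫ p, J (p.1 - p.2) * ((pairL A B x).1 p.1 - (pairL A B x).2 p.2) ^ 2
            ∂((volume.restrict A).prod (volume.restrict B))
        = inner ℝ (TJ (pairL A B x)) (TJ (pairL A B x)) := by
      rw [hTJ]
      simp only [sq, mul_assoc]
    rw [ha, e, real_inner_self_eq_norm_sq (gradL A B x)]
    -- The `G` part is simply dropped, being half of a squared norm.
    linarith [real_inner_self_nonneg (F := Lp ℝ 2 ((volume.restrict B).prod (volume.restrict B)))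
      (x := TG ((pairL A B x).2, (pairL A B x).2))]

/-- The nonlocal Poincaré inequality on pairs of total mean zero. -/
theorem IsAdmissibleKernel.exists_norm_sq_le (hJ : IsAdmissibleKernel J) {R : ℝ}
    (hΩ : Bornology.IsBounded (A ∪ B)) (hA : MeasurableSet A) (hB : MeasurableSet B)
    (hAint : (interior A).Nonempty) (hBint : (interior B).Nonempty)
    (hR : Metric.diam (A ∪ B) < R) (hJR : Metric.ball (0 : Space N) R ⊆ tsupport J) :
    ∃ C : ℝ, 0 < C ∧ ∀ w : L2 A × L2 B, (∫ x in A, w.1 x) + (∫ x in B, w.2 x) = 0 →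
      ‖w.1‖ ^ 2 + ‖w.2‖ ^ 2 ≤ C * ∫ p, J (p.1 - p.2) * (w.1 p.1 - w.2 p.2) ^ 2
        ∂((volume.restrict A).prod (volume.restrict B)) := by
  obtain ⟨M, hM⟩ := hJ.exists_bound
  obtain ⟨c, hc0, hc⟩ := hJ.exists_pos_le_integral_min hΩ hR hJR Set.subset_union_left hAint
  obtain ⟨c', hc'0, hc'⟩ := hJ.exists_pos_le_integral_min hΩ hR hJR Set.subset_union_right hBint
  have hν : (volume.restrict B : Measure (Space N)) ≠ 0 := by
    rw [Ne, Measure.restrict_eq_zero]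
    exact ((isOpen_interior.measure_pos volume hBint).trans_le
      (measure_mono interior_subset)).ne'
  obtain ⟨C, hC, hCw⟩ := exists_integral_sq_le_mul_integral_sub_sq
    (μ := volume.restrict A) (ν := volume.restrict B) (k := fun x y => J (x - y)) hν
    (hJ.continuous.measurable.comp (measurable_fst.sub measurable_snd))
    (fun x y => hJ.nonneg _) (fun x y => hM _) hc0 hc'0
    (ae_restrict_of_forall_mem hB fun y hy => ae_restrict_of_forall_mem hB fun y' hy' =>
      hc y (Or.inr hy) y' (Or.inr hy'))
    -- This bound is the diagonal case `y = y' = x` of the overlap estimate on `B`, where the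
    -- minimum collapses; radiality exchanges `y - x` and `x - y`.
    (ae_restrict_of_forall_mem hA fun x hx => by
      refine (hc' x (Or.inl hx) x (Or.inl hx)).trans_eq ?_
      refine integral_congr_ae (Filter.Eventually.of_forall fun y => ?_)
      simp only [min_self]
      exact hJ.radial _ _ (norm_sub_rev _ _))
  refine ⟨C, hC, fun w hw => ?_⟩
  rw [norm_sq_L2, norm_sq_L2]
  exact hCw w.1 w.2 (Lp.stronglyMeasurable _).measurable (Lp.stronglyMeasurable _).measurable
    (Lp.memLp _) (Lp.memLp _) hw

variable (A B) in
/-- The constant pair `(c, c)`. -/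
noncomputable def constPair (c : ℝ) : L2 A × L2 B :=
  (Lp.const 2 (volume.restrict A) c, Lp.const 2 (volume.restrict B) c)

theorem constPair_fst_mem (c : ℝ) : (constPair A B c).1 ∈ H1 A := ⟨0, hasWeakGrad_const c⟩

/-- A constant pair has zero gradient and zero differences. Together with `load_constPair`, where
the compatibility condition on `f` enters, this frees the test pairs from the mean-zero constraint.
-/
theorem form_constPair (hA : MeasurableSet A) (hAnull : volume (A \ interior A) = 0)
    (w : L2 A × L2 B) (c : ℝ) : form J G w (constPair A B c) = 0 := by
  have hg : weakGrad (constPair A B c).1 = 0 := (hasWeakGrad_const c).weakGrad_eq hA hAnull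
  have hcA := Lp.coeFn_const (p := 2) (μ := (volume.restrict A : Measure (Space N))) c
  have hcB := Lp.coeFn_const (p := 2) (μ := (volume.restrict B : Measure (Space N))) c
  have h1 : ∫ x in A, inner ℝ (weakGrad w.1 x) (weakGrad (constPair A B c).1 x) = 0 := by
    rw [hg]
    refine integral_eq_zero_of_ae ?_
    filter_upwards [Lp.coeFn_zero (Space N) 2 (volume.restrict A)] with x hx
    rw [hx]; simp
  have h2 : ∫ p in B ×ˢ B, G (p.1 - p.2) * (w.2 p.2 - w.2 p.1)
      * ((constPair A B c).2 p.2 - (constPair A B c).2 p.1) = 0 := by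
    rw [Measure.volume_eq_prod, ← Measure.prod_restrict]
    refine integral_eq_zero_of_ae ?_
    filter_upwards [Measure.quasiMeasurePreserving_fst.ae_eq_comp hcB,
      Measure.quasiMeasurePreserving_snd.ae_eq_comp hcB] with p e1 e2
    simp only [Function.comp_apply, Function.const_apply] at e1 e2
    simp only [constPair, Pi.zero_apply]
    rw [e1, e2, sub_self, mul_zero]
  have h3 : ∫ p in A ×ˢ B, J (p.1 - p.2) * (w.1 p.1 - w.2 p.2)
      * ((constPair A B c).1 p.1 - (constPair A B c).2 p.2) = 0 := by
    rw [Measure.volume_eq_prod, ← Measure.prod_restrict]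
    refine integral_eq_zero_of_ae ?_
    filter_upwards [Measure.quasiMeasurePreserving_fst.ae_eq_comp hcA,
      Measure.quasiMeasurePreserving_snd.ae_eq_comp hcB] with p e1 e2
    simp only [Function.comp_apply, Function.const_apply] at e1 e2
    simp only [constPair, Pi.zero_apply]
    rw [e1, e2, sub_self, mul_zero]
  rw [form, h1, h2, h3]
  ring

theorem load_constPair {f : Space N → ℝ} (hf0 : (∫ x in A, f x) + (∫ x in B, f x) = 0) (c : ℝ) :
    load f (constPair A B c) = 0 := by
  have h1 : ∫ x in A, f x * (constPair A B c).1 x = ∫ x in A, f x * c := by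
    refine integral_congr_ae ?_
    filter_upwards [Lp.coeFn_const (p := 2) (μ := (volume.restrict A : Measure (Space N))) c]
      with x hx
    rw [constPair, hx]; rfl
  have h2 : ∫ x in B, f x * (constPair A B c).2 x = ∫ x in B, f x * c := by
    refine integral_congr_ae ?_
    filter_upwards [Lp.coeFn_const (p := 2) (μ := (volume.restrict B : Measure (Space N))) c]
      with x hx
    rw [constPair, hx]; rfl
  rw [load, h1, h2, integral_mul_const, integral_mul_const, ← add_mul, hf0, zero_mul]

theorem exists_sub_constPair_mem_W (hAint : (interior A).Nonempty) {t : L2 A × L2 B}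
    (ht : t.1 ∈ H1 A) : ∃ c : ℝ, t - constPair A B c ∈ W A B := by
  have hpos : 0 < volume.real A + volume.real B := by
    have h : 0 < volume.real A := by
      rw [measureReal_def, ENNReal.toReal_pos_iff]
      refine ⟨(isOpen_interior.measure_pos volume hAint).trans_le
        (measure_mono interior_subset), ?_⟩
      simpa using measure_lt_top (volume.restrict A) Set.univ
    positivity
  -- The combined mean of the pair; the denominator is positive because `A` has nonempty interior.
  set c := ((∫ x in A, t.1 x) + ∫ x in B, t.2 x) / (volume.real A + volume.real B) with hc
  refine ⟨c, (H1 A).sub_mem ht (constPair_fst_mem c), ?_⟩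
  have hint (S : Set (Space N)) [IsFiniteMeasure (volume.restrict S)] (u : L2 S) :
      ∫ x in S, (u - (Lp.const 2 (volume.restrict S) c : L2 S)) x
        = (∫ x in S, u x) - volume.real S * c := by
    rw [show volume.real S * c = ∫ _ in S, c by simp,
      ← integral_sub ((Lp.memLp u).integrable (by norm_num)) (integrable_const c)]
    refine integral_congr_ae ?_
    filter_upwards [Lp.coeFn_sub u (Lp.const 2 (volume.restrict S) c : L2 S),
      Lp.coeFn_const (p := 2) (μ := (volume.restrict S : Measure (Space N))) c] with x h1 h2
    rw [h1, Pi.sub_apply, h2]; rfl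
  simp only [constPair, Prod.fst_sub, Prod.snd_sub, hint]
  have := div_mul_cancel₀ ((∫ x in A, t.1 x) + ∫ x in B, t.2 x) hpos.ne'
  rw [← hc] at this
  linarith

end Form

end LocalNonlocal

/-! ### Existence, uniqueness and the variational characterization. -/

open LocalNonlocal
theorem mainTheorem6 {N : ℕ} (Ω A B : Set (Space N)) (J G : Space N → ℝ) (R : ℝ)
    (hΩ : Bornology.IsBounded Ω) (hAB : Ω = A ∪ B) (hdisj : Disjoint A B)
    (hA : MeasurableSet A) (hB : MeasurableSet B)
    (hAint : (interior A).Nonempty) (hBint : (interior B).Nonempty)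
    (hAnull : volume (A \ interior A) = 0)
    (hJ : IsAdmissibleKernel J) (hG : IsAdmissibleKernel G)
    (hR : Metric.diam (A ∪ B) < R) (hJR : Metric.ball (0 : Space N) R ⊆ tsupport J)
    (f : Space N → ℝ) (hf : MemLp f 2 (volume.restrict Ω))
    (hf0 : (∫ x in A, f x) + (∫ x in B, f x) = 0) :
    ∃ w : L2 A × L2 B, IsWeakSolution J G f w ∧ IsEnergyMinimizer J G f w ∧
      (∀ w' : L2 A × L2 B, IsWeakSolution J G f w' → w' = w) ∧
      (∀ w' : L2 A × L2 B, IsEnergyMinimizer J G f w' → w' = w) ∧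
      (∀ t : L2 A × L2 B, t.1 ∈ H1 A → form J G w t = - load f t) := by
  subst hAB
  have fin {S : Set (Space N)} (hS : S ⊆ A ∪ B) : IsFiniteMeasure (volume.restrict S) :=
    isFiniteMeasure_restrict.2 (hΩ.subset hS).measure_lt_top.ne
  have := fin Set.subset_union_left
  have := fin Set.subset_union_right
  have hfA : MemLp f 2 (volume.restrict A) :=
    hf.mono_measure (Measure.restrict_mono_set _ Set.subset_union_left)
  have hfB : MemLp f 2 (volume.restrict B) :=
    hf.mono_measure (Measure.restrict_mono_set _ Set.subset_union_right)
  obtain ⟨a, ha, hsymm, hlower⟩ := exists_bilinear_eq_form A B hJ hG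
  obtain ⟨l, hl⟩ := exists_linear_eq_load A B hfA hfB
  obtain ⟨C, hC, hpoinc⟩ := hJ.exists_norm_sq_le hΩ hA hB hAint hBint hR hJR
  -- If `I` is the `J` integral, then `‖x‖² ≤ C I + ‖g‖² ≤ (1 + C)(I + ‖g‖²)`.
  have hcoer : ∀ x ∈ meanZeroGraph A B, (1 + C)⁻¹ * ‖x‖ ^ 2 ≤ a x x := by
    intro x hx
    have h1 := hpoinc _ hx.2
    have h2 := hlower x
    rw [norm_sq_triple, inv_mul_le_iff₀ (by positivity)]
    have h3 : 0 ≤ ∫ p, J (p.1 - p.2) * ((pairL A B x).1 p.1 - (pairL A B x).2 p.2) ^ 2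
        ∂((volume.restrict A).prod (volume.restrict B)) :=
      integral_nonneg fun p => mul_nonneg (hJ.nonneg _) (sq_nonneg _)
    nlinarith [sq_nonneg ‖gradL A B x‖]
  have hpos : ∀ h ∈ W A B, form J G h h ≤ 0 → h = 0 := by
    intro h hh hle
    have h1 := hcoer _ (lift_mem_meanZeroGraph hh)
    rw [← ha] at h1
    have h2 : ‖lift h‖ ^ 2 ≤ 0 := by
      have hC' : 0 < (1 + C)⁻¹ := by positivity
      nlinarith
    have h3 : lift h = 0 := by
      rw [← norm_eq_zero, ← sq_eq_zero_iff]
      exact le_antisymm h2 (sq_nonneg _)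
    rw [← pairL_lift h, h3, map_zero]
  obtain ⟨z, hzV, hzsol⟩ := exists_forall_eq_neg_of_coercive isClosed_meanZeroGraph a l
    (by positivity) hcoer
  obtain ⟨w, hwW, hlw⟩ : ∃ w ∈ W A B, lift w = z :=
    ⟨_, pairL_mem_W hzV, lift_pairL hA hAnull hzV⟩
  have hsol : ∀ t ∈ W A B, form J G w t = - load f t := by
    intro t ht
    rw [ha, hl, hlw]
    exact hzsol _ (lift_mem_meanZeroGraph ht)
  -- Expanding around `w` with `h = w' - w`, the first-order part `a(w, h) + F(h)` vanishes because
  -- `h` is an admissible test pair.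
  have henergy : ∀ w' ∈ W A B, energy J G f w'
      = energy J G f w + 1 / 2 * form J G (w' - w) (w' - w) := by
    intro w' hw'
    have hd := W_sub hw' hwW
    have e : lift w' = lift w + lift (w' - w) := by
      rw [← lift_add hA hAnull hwW.1 hd.1, add_sub_cancel]
    have h1 := hsol _ hd
    rw [ha, hl] at h1
    rw [energy_eq, energy_eq, ha, ha, ha, hl, hl, e]
    simp only [map_add, add_apply]
    rw [hsymm (lift (w' - w)) (lift w), h1]
    ring
  have hnn : ∀ h ∈ W A B, 0 ≤ form J G h h := by
    intro h hh
    rw [ha]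
    exact le_trans (by positivity) (hcoer _ (lift_mem_meanZeroGraph hh))
  refine ⟨w, ⟨hwW, hsol⟩, ⟨hwW, fun w' hw' => ?_⟩, fun w' hw' => ?_, fun w' hw' => ?_,
    fun t ht => ?_⟩
  · rw [henergy w' hw']
    linarith [hnn _ (W_sub hw' hwW)]
  -- Both solutions are tested against their difference; subtracting leaves `a(w'-w, w'-w) = 0`, and
  -- `hpos` applies.
  · have hd := W_sub hw'.1 hwW
    have e : lift w' = lift w + lift (w' - w) := by
      rw [← lift_add hA hAnull hwW.1 hd.1, add_sub_cancel]
    have h1 := hsol _ hd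
    have h2 := hw'.2 _ hd
    rw [ha] at h1
    rw [ha, e, map_add, add_apply, h1, ← ha] at h2
    exact sub_eq_zero.1 (hpos _ hd (by linarith))
  -- Minimality of `w'` compared with `w` forces the quadratic remainder in `henergy` to be
  -- nonpositive.
  · have hd := W_sub hw'.1 hwW
    have h1 := hw'.2 w hwW
    rw [henergy w' hw'.1] at h1
    exact sub_eq_zero.1 (hpos _ hd (by linarith))
  -- Subtracting the combined mean puts the test pair in `W`, and the constant pair contributes zero
  -- to both sides.
  · obtain ⟨c, hc⟩ := exists_sub_constPair_mem_W hAint ht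
    have e : lift t = lift (t - constPair A B c) + lift (constPair A B c) := by
      rw [← lift_add hA hAnull hc.1 (constPair_fst_mem c), sub_add_cancel]
    have h1 := hsol _ hc
    have h2 := form_constPair (J := J) (G := G) hA hAnull w c
    have h3 := load_constPair hf0 c
    rw [ha, hl] at h1
    rw [ha] at h2
    rw [hl] at h3
    rw [ha, hl, e, map_add, map_add, h1, h2, h3]
    ring
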